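/- For a positive integer $n$ let $[n]=\{1,\dots,n\}$. In the problem $\mathrm{Permutation}_n$ one is given oracle access to a permutation $\pi$ of $[n]$ and has to answer "yes" if $\pi^{-1}(1)$ is even and "no" if it is odd. A quantum algorithm making $q$ queries works on a state space with orthonormal basis $|x,y,w\rangle$, where $x\in[n]$, $y$ ranges over a finite abelian group $G$ (the answer register), and $w$ ranges over a finite set (the workspace). It starts in a basis state, applies unitaries $U_0,U_1,\dots,U_q$ that do not depend on $\pi$, with one oracle call $|x,y,w\rangle\mapsto|x,y+e(\pi(x)),w\rangle$ between any two consecutive ones, where $e:[n]\to G$ is a fixed injection (for example, bit strings with bitwise XOR, or addition modulo $n$). It then measures in the computational basis and answers according to whether the outcome lies in a fixed set. Its distributional error is its probability of error for a uniformly random permutation $\pi$ of $[n]$ and its worst-case error is its maximum probability of error over all permutations $\pi$ of $[n]$. Any quantum algorithm that solves $\mathrm{Permutation}_n$ with constant distributional error $\varepsilon<1/2$ on the uniform distribution over permutations of $[n]$ requires $\Omega(\sqrt n\,)$ queries, and the same lower bound holds for worst-case error at most $\varepsilon$. Precisely: for every real $\varepsilon<1/2$ there is a constant $c>0$, depending only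 on $\varepsilon$, such that for every integer $n>1$, every finite abelian group $G$, every injection $e:[n]\to G$ and every quantum algorithm making $q$ queries: 1. if the distributional error of the algorithm is at most $\varepsilon$, and $n$ is even or $\varepsilon+\frac1{2n}<\frac12$ (which holds for all sufficiently large $n$), then $q\ge c\sqrt n$; 2. if the worst-case error of the algorithm is at most $\varepsilon$, then $q\ge c\sqrt n$. -/

import Mathlib

noncomputable section

namespace PermutationInversion

/-- The set `[n] = {1, 2, …, n}`. -/
abbrev Idx (n : ℕ) : Type := {i : ℕ // i ∈ Finset.Icc 1 n}

/-- `π` is a "yes" instance of `Permutation_n`: the pre-image of `1` under `π` is even. -/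
def IsYes {n : ℕ} (π : Equiv.Perm (Idx n)) : Prop :=
  ∃ i : Idx n, (π i : ℕ) = 1 ∧ Even (i : ℕ)

/-- A quantum query algorithm with query register `[n]`, answer register `G` and an arbitrary
finite workspace `W`.  Its state space is `ℂ ^ ([n] × G × W)`.  It starts in a computational basis
state, applies input-independent unitaries `U 0, U 1, …, U queries` with one oracle call between
any two consecutive ones, measures in the computational basis, and answers "yes" if the outcome
lies in `accept`.  The entries `U t` with `t > queries` are never used. -/
structure QuantumAlgorithm (n : ℕ) (G : Type) [Fintype G] [DecidableEq G] where
  W : Type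
  [fintypeW : Fintype W]
  [decEqW : DecidableEq W]
  queries : ℕ
  init : Idx n × G × W
  U : ℕ → Matrix.unitaryGroup (Idx n × G × W) ℂ
  accept : Finset (Idx n × G × W)

attribute [instance] QuantumAlgorithm.fintypeW QuantumAlgorithm.decEqW

/-- The action of the oracle for `f : [n] → [n]` on basis states,
`|x, y, w⟩ ↦ |x, y + e (f x), w⟩`, where `e` encodes the elements of `[n]` in the abelian
group `G` of contents of the answer register. -/
def oracle {n : ℕ} {G : Type} [AddCommGroup G] (W : Type) (e : Idx n → G)
    (f : Idx n → Idx n) : Equiv.Perm (Idx n × G × W) where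
  toFun b := (b.1, b.2.1 + e (f b.1), b.2.2)
  invFun b := (b.1, b.2.1 - e (f b.1), b.2.2)
  left_inv b := by simp
  right_inv b := by simp

namespace QuantumAlgorithm

variable {n : ℕ} {G : Type} [AddCommGroup G] [Fintype G] [DecidableEq G]

/-- The state after `t` oracle calls to `f` (and the unitary following the last of them).
The oracle acts linearly on states by permuting the basis states. -/
def state (A : QuantumAlgorithm n G) (e : Idx n → G) (f : Idx n → Idx n) :
    ℕ → (Idx n × G × A.W → ℂ)
  | 0 => (A.U 0).1.mulVec (Pi.single A.init 1)
  | t + 1 => (A.U (t + 1)).1.mulVec fun b => A.state e f t ((oracle A.W e f).symm b)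

/-- The probability that the algorithm answers "yes" when run with the oracle for `f`. -/
def acceptProb (A : QuantumAlgorithm n G) (e : Idx n → G) (f : Idx n → Idx n) : ℝ :=
  ∑ b ∈ A.accept, ‖A.state e f A.queries b‖ ^ 2

open Classical in
/-- The probability that the algorithm errs on the instance `π` of `Permutation_n`. -/
def errorProb (A : QuantumAlgorithm n G) (e : Idx n → G) (π : Equiv.Perm (Idx n)) : ℝ :=
  if IsYes π then 1 - A.acceptProb e π else A.acceptProb e π

/-- The distributional error for the uniform distribution over permutations of `[n]`. -/
def uniformError (A : QuantumAlgorithm n G) (e : Idx n → G) : ℝ :=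
  (∑ π : Equiv.Perm (Idx n), A.errorProb e π) / (Fintype.card (Equiv.Perm (Idx n)) : ℝ)

end QuantumAlgorithm

end PermutationInversion

end

/-! The proof is a hybrid argument along an involution. Let `π` be a permutation with `π i = 1`, let
`j` be a point, and let `π'` be `π` with the values at `i` and `j` exchanged. Writing 1 at `j` in
`π`, or at `i` in `π'`, gives the same function, in general not injective (`update_movePreimage`). A
run of `q` queries on `π` puts little amplitude on a random `j`, so this change moves the acceptance
probability by at most `4q/√n` on average over `j` (`sum_abs_acceptProb_update_le`). Since `(π, j) ↦
(π', i)` is an involution, the same bound holds on the side of `π'`, and `π`, `π'` differ by at most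
`8q/√n` on average.

For `i` even and `j` odd the correct answers are opposite, so a small `q` forces errors
(`weighted_error_ge`). With `a = ⌊n/2⌋` even points, yes-instances get weight `n - a` and
no-instances weight `a`. For odd `n` these differ, and always answering "no" errs with probability
only `1/2 - 1/(2n)`; hence the parity condition in the distributional claim. The worst-case claim
bounds each class separately and needs no such condition. -/

noncomputable section

namespace PermutationInversion

/-! ### Euclidean norms of amplitude vectors -/

section EuclideanNorm

variable {ι : Type*} [Fintype ι]

/-- The Euclidean norm of a vector of amplitudes. -/
def l2norm (v : ι → ℂ) : ℝ := ‖WithLp.toLp 2 v‖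

lemma l2norm_nonneg (v : ι → ℂ) : 0 ≤ l2norm v := norm_nonneg _

lemma l2norm_sq (v : ι → ℂ) : l2norm v ^ 2 = ∑ b, ‖v b‖ ^ 2 :=
  EuclideanSpace.norm_sq_eq _

lemma l2norm_add_le (u v : ι → ℂ) : l2norm (u + v) ≤ l2norm u + l2norm v :=
  norm_add_le (WithLp.toLp 2 u) (WithLp.toLp 2 v)

lemma l2norm_sub_le (u v : ι → ℂ) : l2norm (u - v) ≤ l2norm u + l2norm v :=
  norm_sub_le (WithLp.toLp 2 u) (WithLp.toLp 2 v)

lemma abs_l2norm_sub_le (u v : ι → ℂ) : |l2norm u - l2norm v| ≤ l2norm (u - v) :=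
  abs_norm_sub_norm_le (WithLp.toLp 2 u) (WithLp.toLp 2 v)

lemma l2norm_comp_equiv (v : ι → ℂ) (σ : Equiv.Perm ι) :
    l2norm (fun b => v (σ b)) = l2norm v := by
  rw [← sq_eq_sq₀ (l2norm_nonneg _) (l2norm_nonneg _), l2norm_sq, l2norm_sq]
  exact Equiv.sum_comp σ fun b => ‖v b‖ ^ 2

lemma l2norm_unitary_mulVec [DecidableEq ι] (U : Matrix.unitaryGroup ι ℂ) (v : ι → ℂ) :
    l2norm (U.1.mulVec v) = l2norm v := by
  have h (w : ι → ℂ) : ((l2norm w ^ 2 : ℝ) : ℂ) = star w ⬝ᵥ w := by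
    simp [l2norm_sq, dotProduct, Complex.conj_mul']
  rw [← sq_eq_sq₀ (l2norm_nonneg _) (l2norm_nonneg _)]
  apply Complex.ofReal_injective
  rw [h, h, Matrix.star_mulVec, Matrix.dotProduct_mulVec, Matrix.vecMul_vecMul,
    ← Matrix.star_eq_conjTranspose, Matrix.UnitaryGroup.star_mul_self, Matrix.vecMul_one]

lemma l2norm_single [DecidableEq ι] (b : ι) : l2norm (Pi.single b (1 : ℂ)) = 1 := by
  have : l2norm (Pi.single b (1 : ℂ)) ^ 2 = 1 := by
    rw [l2norm_sq, Finset.sum_eq_single b] <;> simp +contextual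
  exact (pow_eq_one_iff_of_nonneg (l2norm_nonneg _) two_ne_zero).1 this

open Classical in
lemma l2norm_indicator_sq (s : Set ι) (v : ι → ℂ) :
    l2norm (s.indicator v) ^ 2 = ∑ b with b ∈ s, ‖v b‖ ^ 2 := by
  rw [l2norm_sq, Finset.sum_filter]
  refine Finset.sum_congr rfl fun b _ => ?_
  by_cases h : b ∈ s <;> simp [h]

lemma l2norm_indicator_le (s : Set ι) (v : ι → ℂ) : l2norm (s.indicator v) ≤ l2norm v := by
  classical
  rw [← sq_le_sq₀ (l2norm_nonneg _) (l2norm_nonneg _), l2norm_indicator_sq, l2norm_sq]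
  exact Finset.sum_le_sum_of_subset_of_nonneg (Finset.filter_subset _ _)
    fun _ _ _ => by positivity

/-- Measuring two states of norm one gives probabilities that differ by at most twice the
distance between the states. -/
lemma abs_sum_sq_sub_sum_sq_le (s : Finset ι) {u v : ι → ℂ} (hu : l2norm u = 1)
    (hv : l2norm v = 1) :
    |∑ b ∈ s, ‖u b‖ ^ 2 - ∑ b ∈ s, ‖v b‖ ^ 2| ≤ 2 * l2norm (u - v) := by
  have h (w : ι → ℂ) : ∑ b ∈ s, ‖w b‖ ^ 2 = l2norm ((s : Set ι).indicator w) ^ 2 := by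
    classical
    rw [l2norm_indicator_sq]
    congr 1
    ext; simp
  have hu' := l2norm_indicator_le (s : Set ι) u
  have hv' := l2norm_indicator_le (s : Set ι) v
  have hu0 := l2norm_nonneg ((s : Set ι).indicator u)
  have hv0 := l2norm_nonneg ((s : Set ι).indicator v)
  have hd : |l2norm ((s : Set ι).indicator u) - l2norm ((s : Set ι).indicator v)|
      ≤ l2norm (u - v) := by
    refine (abs_l2norm_sub_le _ _).trans ?_
    rw [← Set.indicator_sub']
    exact l2norm_indicator_le _ _
  rw [h, h, sq_sub_sq, abs_mul, abs_of_nonneg (by linarith)]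
  exact mul_le_mul (by linarith) hd (abs_nonneg _) (by norm_num)

/-- The sum of the norms of the components of a vector in `n` orthogonal subspaces is at most
`√n` times the norm of the vector. -/
lemma sum_l2norm_fiber_le {κ : Type*} [Fintype κ] (p : ι → κ) (v : ι → ℂ) :
    ∑ j, l2norm ((p ⁻¹' {j}).indicator v) ≤ √(Fintype.card κ) * l2norm v := by
  classical
  have hsq : ∑ j, l2norm ((p ⁻¹' {j}).indicator v) ^ 2 = l2norm v ^ 2 := by
    rw [l2norm_sq, ← Finset.sum_fiberwise Finset.univ p]
    refine Finset.sum_congr rfl fun j _ => ?_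
    rw [l2norm_indicator_sq]
    congr 1
  have h := sq_sum_le_card_mul_sum_sq (s := Finset.univ)
    (f := fun j => l2norm ((p ⁻¹' {j}).indicator v))
  rw [hsq, Finset.card_univ] at h
  refine (abs_le_of_sq_le_sq' ?_ (by have := l2norm_nonneg v; positivity)).2
  rwa [mul_pow, Real.sq_sqrt (by positivity)]

end EuclideanNorm

/-! ### The hybrid argument for a single run -/

namespace QuantumAlgorithm

variable {n : ℕ} {G : Type} [AddCommGroup G] [Fintype G] [DecidableEq G]

lemma l2norm_state (A : QuantumAlgorithm n G) (e : Idx n → G) (f : Idx n → Idx n) (t : ℕ) :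
    l2norm (A.state e f t) = 1 := by
  induction t with
  | zero => rw [state, l2norm_unitary_mulVec, l2norm_single]
  | succ t ih => rw [state, l2norm_unitary_mulVec, l2norm_comp_equiv, ih]

lemma acceptProb_nonneg (A : QuantumAlgorithm n G) (e : Idx n → G) (f : Idx n → Idx n) :
    0 ≤ A.acceptProb e f :=
  Finset.sum_nonneg fun _ _ => by positivity

lemma acceptProb_le_one (A : QuantumAlgorithm n G) (e : Idx n → G) (f : Idx n → Idx n) :
    A.acceptProb e f ≤ 1 := by
  have h := l2norm_sq (A.state e f A.queries)
  rw [l2norm_state, one_pow] at h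
  rw [h]
  exact Finset.sum_le_sum_of_subset_of_nonneg (Finset.subset_univ _) fun _ _ _ => by positivity

lemma errorProb_nonneg (A : QuantumAlgorithm n G) (e : Idx n → G) (π : Equiv.Perm (Idx n)) :
    0 ≤ A.errorProb e π := by
  rw [errorProb]
  split_ifs
  · linarith [A.acceptProb_le_one e π]
  · exact A.acceptProb_nonneg e π

/-- The part of the state after `t` queries in which the query register holds `j`. -/
def queryPart (A : QuantumAlgorithm n G) (e : Idx n → G) (f : Idx n → Idx n) (t : ℕ)
    (j : Idx n) : Idx n × G × A.W → ℂ :=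
  (Prod.fst ⁻¹' {j}).indicator (A.state e f t)

/-- The states for two oracles that differ only at `j` drift apart, with every query, by at most
twice the amplitude with which `j` is queried. -/
lemma l2norm_state_sub_le (A : QuantumAlgorithm n G) (e : Idx n → G) {f g : Idx n → Idx n}
    {j : Idx n} (hfg : ∀ i, i ≠ j → f i = g i) (t : ℕ) :
    l2norm (A.state e f t - A.state e g t) ≤
      ∑ s ∈ Finset.range t, 2 * l2norm (A.queryPart e f s j) := by
  induction t with
  | zero => simp [state, l2norm]
  | succ t ih =>
    rw [Finset.sum_range_succ, state, state, ← Matrix.mulVec_sub, l2norm_unitary_mulVec]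
    -- Compare both runs under the oracle of `g`: the old difference is merely permuted, and the new
    -- error comes only from the part of the state that queries `j`.
    have key : (fun b => A.state e f t ((oracle A.W e f).symm b)) -
        (fun b => A.state e g t ((oracle A.W e g).symm b)) =
        (fun b => (A.state e f t - A.state e g t) ((oracle A.W e g).symm b)) +
        ((fun b => A.queryPart e f t j ((oracle A.W e f).symm b)) -
          fun b => A.queryPart e f t j ((oracle A.W e g).symm b)) := by
      funext ⟨x, y, w⟩
      by_cases hx : x = j
      · subst hx
        simp [oracle, queryPart]
      · simp [oracle, queryPart, hx, hfg x hx]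
    rw [key]
    refine (l2norm_add_le _ _).trans (add_le_add ?_ ?_)
    · rw [l2norm_comp_equiv]
      exact ih
    · refine (l2norm_sub_le _ _).trans_eq ?_
      rw [l2norm_comp_equiv, l2norm_comp_equiv, two_mul]

/-- Changing the oracle at one random place changes the acceptance probability by `O(q / √n)` on
average. -/
lemma sum_abs_acceptProb_update_le (A : QuantumAlgorithm n G) (e : Idx n → G)
    (f : Idx n → Idx n) (k : Idx n) :
    ∑ j, |A.acceptProb e f - A.acceptProb e (Function.update f j k)| ≤
      4 * A.queries * √n := by
  have h1 (j : Idx n) : |A.acceptProb e f - A.acceptProb e (Function.update f j k)| ≤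
      2 * ∑ s ∈ Finset.range A.queries, 2 * l2norm (A.queryPart e f s j) := by
    refine (abs_sum_sq_sub_sum_sq_le _ (A.l2norm_state e f _) (A.l2norm_state e _ _)).trans ?_
    gcongr
    exact A.l2norm_state_sub_le e (fun i hi => (Function.update_of_ne hi _ _).symm) _
  have h2 (s : ℕ) : ∑ j, l2norm (A.queryPart e f s j) ≤ √n := by
    have := sum_l2norm_fiber_le (Prod.fst : Idx n × G × A.W → Idx n) (A.state e f s)
    rw [l2norm_state, mul_one] at this
    simpa [queryPart] using this
  calc _ ≤ ∑ j, 2 * ∑ s ∈ Finset.range A.queries, 2 * l2norm (A.queryPart e f s j) :=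
        Finset.sum_le_sum fun j _ => h1 j
    _ = 4 * ∑ s ∈ Finset.range A.queries, ∑ j, l2norm (A.queryPart e f s j) := by
        simp only [← Finset.mul_sum]
        rw [Finset.sum_comm]
        ring
    _ ≤ 4 * ∑ s ∈ Finset.range A.queries, √n := by
        gcongr with s
        exact h2 s
    _ = _ := by simp; ring

end QuantumAlgorithm

/-! ### The involution on pairs of a permutation and a point -/

section Swap

variable {α : Type*} [DecidableEq α]

/-- Exchange the pre-image `i` of `k` under `π` with `j`, and remember `i`. -/
def movePreimage (k : α) : Equiv.Perm (Equiv.Perm α × α) :=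
  Function.Involutive.toPerm
    (fun p => (p.1 * Equiv.swap (p.1.symm k) p.2, p.1.symm k)) (by
      rintro ⟨π, j⟩
      have h : (π * Equiv.swap (π.symm k) j).symm k = j := by
        rw [Equiv.symm_apply_eq]; simp
      simp only [h, Prod.mk.injEq, and_true]
      rw [Equiv.swap_comm j, mul_assoc, Equiv.swap_mul_self, mul_one])

lemma movePreimage_fst (k : α) (p : Equiv.Perm α × α) :
    (movePreimage k p).1 = p.1 * Equiv.swap (p.1.symm k) p.2 := rfl

lemma movePreimage_snd (k : α) (p : Equiv.Perm α × α) :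
    (movePreimage k p).2 = p.1.symm k := rfl

lemma movePreimage_symm_apply (k : α) (p : Equiv.Perm α × α) :
    (movePreimage k p).1.symm k = p.2 := by
  rw [Equiv.symm_apply_eq]; simp [movePreimage_fst]

/-- A permutation and the one with the moved pre-image become the same function when `k` is
written into the other's pre-image of `k`. -/
lemma update_movePreimage (k : α) (p : Equiv.Perm α × α) :
    Function.update (movePreimage k p).1 (movePreimage k p).2 k = Function.update p.1 p.2 k := by
  obtain ⟨π, j⟩ := p
  funext x
  simp only [movePreimage_fst, movePreimage_snd, Function.update_apply,
    Equiv.Perm.coe_mul, Function.comp_apply]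
  by_cases h1 : x = π.symm k
  · subst h1; simp
  · by_cases h2 : x = j
    · subst h2; simp
    · simp [h1, h2, Equiv.swap_apply_of_ne_of_ne]

/-- Pairs of a permutation with pre-image of `k` in `s` and a point outside `s` correspond to
pairs of a permutation with pre-image of `k` outside `s` and a point of `s`. -/
lemma sum_movePreimage [Fintype α] (k : α) (s : Finset α) (F : Equiv.Perm α → ℝ) :
    ∑ p : Equiv.Perm α × α with p.1.symm k ∈ s ∧ p.2 ∉ s, F (movePreimage k p).1 =
      ∑ p : Equiv.Perm α × α with p.1.symm k ∉ s ∧ p.2 ∈ s, F p.1 := by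
  refine Finset.sum_equiv (movePreimage k) (fun p => ?_) fun p _ => rfl
  simp [movePreimage_symm_apply, movePreimage_snd, and_comm]

lemma sum_pair_filter [Fintype α] (P : Equiv.Perm α → Prop) [DecidablePred P] (s : Finset α)
    (F : Equiv.Perm α → ℝ) :
    ∑ p : Equiv.Perm α × α with P p.1 ∧ p.2 ∈ s, F p.1 =
      s.card * ∑ π with P π, F π := by
  have : (Finset.univ.filter fun p : Equiv.Perm α × α => P p.1 ∧ p.2 ∈ s) =
      (Finset.univ.filter P) ×ˢ s := by
    ext; simp
  rw [this, Finset.sum_product, Finset.mul_sum]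
  simp

end Swap

/-! ### Counting yes-instances -/

variable {n : ℕ} {G : Type} [AddCommGroup G] [Fintype G] [DecidableEq G]

/-- The element `1` of `[n]`. -/
def one (hn : 1 < n) : Idx n := ⟨1, by simp; omega⟩

/-- The even elements of `[n]`. -/
def evens (n : ℕ) : Finset (Idx n) := Finset.univ.filter fun i => Even (i : ℕ)

lemma isYes_iff (hn : 1 < n) (π : Equiv.Perm (Idx n)) :
    IsYes π ↔ π.symm (one hn) ∈ evens n := by
  simp only [IsYes, evens, Finset.mem_filter, Finset.mem_univ, true_and]
  constructor
  · rintro ⟨i, hi, he⟩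
    have : π i = one hn := Subtype.ext hi
    rwa [← this, Equiv.symm_apply_apply]
  · exact fun h => ⟨_, by simp [one], h⟩

lemma card_evens (n : ℕ) : (evens n).card = n / 2 := by
  rw [← Nat.card_multiples' n 2]
  refine Finset.card_bij (fun i _ => (i : ℕ)) ?_ ?_ ?_
  · rintro ⟨i, hi⟩ h
    simp only [evens, Finset.mem_filter, Finset.mem_univ, true_and, Finset.mem_Icc] at h hi
    simp only [Finset.mem_filter, Finset.mem_range]
    exact ⟨by omega, by omega, h.two_dvd⟩
  · intro _ _ _ _ h
    exact Subtype.ext h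
  · intro i hi
    simp only [Finset.mem_filter, Finset.mem_range] at hi
    exact ⟨⟨i, by simp; omega⟩, by simpa [evens, even_iff_two_dvd] using hi.2.2, rfl⟩

lemma card_evens_compl (n : ℕ) : ((evens n)ᶜ.card : ℝ) = n - (evens n).card := by
  rw [Finset.card_compl, Nat.cast_sub (Finset.card_le_univ _)]
  simp

/-- The pre-image of 1 is uniformly distributed. The involution balances yes-instances paired with
odd points against no-instances paired with even points. -/
lemma card_isYes (hn : 1 < n) :
    (n : ℝ) * (Finset.univ.filter fun π : Equiv.Perm (Idx n) => π.symm (one hn) ∈ evens n).card =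
      (evens n).card * Fintype.card (Equiv.Perm (Idx n)) := by
  have h := sum_movePreimage (one hn) (evens n) fun _ => 1
  have h1 := sum_pair_filter (fun π : Equiv.Perm (Idx n) => π.symm (one hn) ∈ evens n) (evens n)ᶜ
    fun _ => 1
  have h2 := sum_pair_filter (fun π : Equiv.Perm (Idx n) => π.symm (one hn) ∉ evens n) (evens n)
    fun _ => 1
  simp only [Finset.mem_compl] at h1
  rw [h1, h2] at h
  simp only [Finset.sum_const, nsmul_eq_mul, mul_one] at h
  rw [card_evens_compl] at h
  have h3 := Finset.card_filter_add_card_filter_not (s := Finset.univ)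
    fun π : Equiv.Perm (Idx n) => π.symm (one hn) ∈ evens n
  rw [Finset.card_univ] at h3
  rw [← h3]
  push_cast
  linarith

/-! ### From hybrids to error bounds -/

namespace QuantumAlgorithm

/-- Triangle inequality through the common updated function. The involution turns the second half
into the same sum as the first, doubling 4 to 8. -/
lemma sum_abs_acceptProb_movePreimage_le (A : QuantumAlgorithm n G) (e : Idx n → G)
    (k : Idx n) :
    ∑ p : Equiv.Perm (Idx n) × Idx n,
        |A.acceptProb e p.1 - A.acceptProb e (movePreimage k p).1| ≤
      8 * A.queries * √n * Fintype.card (Equiv.Perm (Idx n)) := by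
  let D (p : Equiv.Perm (Idx n) × Idx n) : ℝ :=
    |A.acceptProb e p.1 - A.acceptProb e (Function.update p.1 p.2 k)|
  have hD : ∑ p, D p ≤ 4 * A.queries * √n * Fintype.card (Equiv.Perm (Idx n)) := by
    rw [Fintype.sum_prod_type]
    calc _ ≤ ∑ _π : Equiv.Perm (Idx n), 4 * A.queries * √n :=
          Finset.sum_le_sum fun π _ => A.sum_abs_acceptProb_update_le e π k
      _ = _ := by rw [Finset.sum_const, nsmul_eq_mul, Finset.card_univ, mul_comm]
  have hp (p : Equiv.Perm (Idx n) × Idx n) :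
      |A.acceptProb e p.1 - A.acceptProb e (movePreimage k p).1| ≤
        D p + D (movePreimage k p) := by
    simp only [D, update_movePreimage]
    rw [abs_sub_comm (A.acceptProb e (movePreimage k p).1)]
    exact abs_sub_le _ _ _
  refine (Finset.sum_le_sum fun p _ => hp p).trans ?_
  rw [Finset.sum_add_distrib, Equiv.sum_comp (movePreimage k) D]
  linarith

/-- The errors on the "yes" and the "no" instances, weighted by the number of partners of an
instance, are large when there are few queries. -/
lemma weighted_error_ge (A : QuantumAlgorithm n G) (e : Idx n → G) (hn : 1 < n) :
    ((n : ℝ) - (evens n).card) *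
          (Finset.univ.filter fun π : Equiv.Perm (Idx n) => π.symm (one hn) ∈ evens n).card ≤
      ((n : ℝ) - (evens n).card) * ∑ π with π.symm (one hn) ∈ evens n, A.errorProb e π +
        (evens n).card * ∑ π with π.symm (one hn) ∉ evens n, A.errorProb e π +
        8 * A.queries * √n * Fintype.card (Equiv.Perm (Idx n)) := by
  have h0 := sum_pair_filter (fun π : Equiv.Perm (Idx n) => π.symm (one hn) ∈ evens n) (evens n)ᶜ
    fun _ => 1
  have h1 := sum_pair_filter (fun π : Equiv.Perm (Idx n) => π.symm (one hn) ∈ evens n) (evens n)ᶜ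
    (A.errorProb e)
  have h2 := sum_pair_filter (fun π : Equiv.Perm (Idx n) => π.symm (one hn) ∉ evens n) (evens n)
    (A.errorProb e)
  simp only [Finset.mem_compl, card_evens_compl] at h0 h1
  -- Reindex the no-instances as partners of yes-instances, so that all sums run over the same
  -- pairs.
  rw [← sum_movePreimage] at h2
  rw [← h1, ← h2]
  rw [Finset.sum_const, nsmul_eq_mul, mul_one, Finset.sum_const, nsmul_eq_mul, mul_one] at h0
  rw [← h0, ← Finset.sum_add_distrib, Finset.cast_card]
  have hD := (Finset.sum_le_sum_of_subset_of_nonneg (Finset.filter_subset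
    (fun p : Equiv.Perm (Idx n) × Idx n => p.1.symm (one hn) ∈ evens n ∧ p.2 ∉ evens n)
    Finset.univ) fun p _ _ => abs_nonneg _).trans
    (A.sum_abs_acceptProb_movePreimage_le e (one hn))
  refine le_trans ?_ (add_le_add_right hD _)
  rw [← Finset.sum_add_distrib]
  refine Finset.sum_le_sum fun p hp => ?_
  simp only [Finset.mem_filter, Finset.mem_univ, true_and] at hp
  have hy : IsYes p.1 := (isYes_iff hn _).2 hp.1
  have hno : ¬ IsYes (movePreimage (one hn) p).1 := by
    rw [isYes_iff hn, movePreimage_symm_apply]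
    exact hp.2
  -- On each pair, 1 equals the two errors plus the difference of the acceptance probabilities.
  rw [errorProb, errorProb, if_pos hy, if_neg hno]
  linarith [le_abs_self (A.acceptProb e p.1 - A.acceptProb e (movePreimage (one hn) p).1)]

/-- A lower bound on the number of queries in terms of the distributional error. -/
lemma card_evens_le (A : QuantumAlgorithm n G) (e : Idx n → G) (hn : 1 < n) :
    ((evens n).card : ℝ) ≤ n * A.uniformError e + 16 * A.queries * √n := by
  have hw := A.weighted_error_ge e hn
  have hY := card_isYes hn
  have hS : ∑ π with π.symm (one hn) ∈ evens n, A.errorProb e π +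
      ∑ π with π.symm (one hn) ∉ evens n, A.errorProb e π =
      A.uniformError e * Fintype.card (Equiv.Perm (Idx n)) := by
    rw [Finset.sum_filter_add_sum_filter_not, uniformError, div_mul_cancel₀]
    exact Nat.cast_ne_zero.2 Fintype.card_ne_zero
  have hno : 0 ≤ ∑ π with π.symm (one hn) ∉ evens n, A.errorProb e π :=
    Finset.sum_nonneg fun π _ => A.errorProb_nonneg e π
  have hK : (0 : ℝ) < Fintype.card (Equiv.Perm (Idx n)) := Nat.cast_pos.2 Fintype.card_pos
  have ha : 2 * ((evens n).card : ℝ) ≤ n := by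
    rw [card_evens]
    exact_mod_cast Nat.mul_div_le n 2
  have hn0 : (0 : ℝ) < n := Nat.cast_pos.2 (by omega)
  generalize ((evens n).card : ℝ) = a at *
  generalize (Fintype.card (Equiv.Perm (Idx n)) : ℝ) = K at *
  generalize ∑ π with π.symm (one hn) ∈ evens n, A.errorProb e π = Sy at *
  generalize ∑ π with π.symm (one hn) ∉ evens n, A.errorProb e π = Sn at *
  generalize ((Finset.univ.filter fun π : Equiv.Perm (Idx n) =>
    π.symm (one hn) ∈ evens n).card : ℝ) = Y at *
  have hT : 0 ≤ 8 * A.queries * √n * K := by positivity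
  have hb : 0 < n - a := by linarith
  have h1 : (n - a) * Y ≤ (n - a) * (A.uniformError e * K + 16 * A.queries * √n / n * K) := by
    -- As `a ≤ n - a`, raising the weight of the no-instances to `n - a` leaves only the total error
    -- `Sy + Sn`.
    have h2 : a * Sn ≤ (n - a) * Sn := mul_le_mul_of_nonneg_right (by linarith) hno
    have h3 : 8 * A.queries * √n * K ≤ (n - a) * (16 * A.queries * √n / n * K) := by
      calc 8 * A.queries * √n * K = n / 2 * (16 * A.queries * √n / n * K) := by
            field_simp; ring
        _ ≤ _ := by gcongr; linarith
    rw [mul_add, ← hS]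
    linarith
  have h2 := mul_le_mul_of_nonneg_left (le_of_mul_le_mul_left h1 hb) hn0.le
  rw [hY] at h2
  refine le_of_mul_le_mul_right (h2.trans_eq ?_) hK
  field_simp

/-- A lower bound on the number of queries in terms of the worst-case error. -/
lemma card_evens_mul_le (A : QuantumAlgorithm n G) (e : Idx n → G) (hn : 1 < n) {ε : ℝ}
    (hA : ∀ π, A.errorProb e π ≤ ε) :
    (1 - 2 * ε) * ((evens n).card * ((n : ℝ) - (evens n).card)) ≤
      8 * A.queries * √n * n := by
  have hw := A.weighted_error_ge e hn
  have hY := card_isYes hn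
  have hN := Finset.card_filter_add_card_filter_not (s := Finset.univ)
    fun π : Equiv.Perm (Idx n) => π.symm (one hn) ∈ evens n
  rw [Finset.card_univ] at hN
  have hN' := congrArg (Nat.cast (R := ℝ)) hN
  push_cast at hN'
  have hyes := Finset.sum_le_card_nsmul
    (Finset.univ.filter fun π : Equiv.Perm (Idx n) => π.symm (one hn) ∈ evens n)
    (A.errorProb e) ε fun π _ => hA π
  have hno := Finset.sum_le_card_nsmul
    (Finset.univ.filter fun π : Equiv.Perm (Idx n) => π.symm (one hn) ∉ evens n)
    (A.errorProb e) ε fun π _ => hA π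
  rw [nsmul_eq_mul] at hyes hno
  have hK : (0 : ℝ) < Fintype.card (Equiv.Perm (Idx n)) := Nat.cast_pos.2 Fintype.card_pos
  have ha0 : (0 : ℝ) ≤ (evens n).card := Nat.cast_nonneg _
  have ha : 2 * ((evens n).card : ℝ) ≤ n := by
    rw [card_evens]
    exact_mod_cast Nat.mul_div_le n 2
  have hn0 : (0 : ℝ) < n := Nat.cast_pos.2 (by omega)
  generalize ((evens n).card : ℝ) = a at *
  generalize (Fintype.card (Equiv.Perm (Idx n)) : ℝ) = K at *
  generalize ∑ π with π.symm (one hn) ∈ evens n, A.errorProb e π = Sy at *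
  generalize ∑ π with π.symm (one hn) ∉ evens n, A.errorProb e π = Sn at *
  generalize ((Finset.univ.filter fun π : Equiv.Perm (Idx n) =>
    π.symm (one hn) ∈ evens n).card : ℝ) = Y at *
  generalize ((Finset.univ.filter fun π : Equiv.Perm (Idx n) =>
    π.symm (one hn) ∉ evens n).card : ℝ) = N at *
  -- The weighted class sizes `(n - a) * Y` and `a * N` agree (both are `a * (n - a) * K / n`), so
  -- `ε` enters symmetrically as `1 - 2ε`.
  have h1 := mul_le_mul_of_nonneg_left hyes (show 0 ≤ n - a by linarith)
  have h2 := mul_le_mul_of_nonneg_left hno ha0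
  have h3 : (n - a) * Y ≤ (n - a) * (Y * ε) + a * (N * ε) + 8 * A.queries * √n * K := by
    linarith
  have h4 := mul_le_mul_of_nonneg_left h3 hn0.le
  have hN2 : n * N = (n - a) * K := by linear_combination n * hN' - hY
  refine le_of_mul_le_mul_right ?_ hK
  linear_combination h4 + ((n - a) * ε - (n - a)) * hY + a * ε * hN2

end QuantumAlgorithm

end PermutationInversion

end

theorem corollary2 (ε : ℝ) (hε : ε < 1 / 2) :
    ∃ c : ℝ, 0 < c ∧
      ∀ (n : ℕ), 1 < n →
      ∀ (G : Type) [AddCommGroup G] [Fintype G] [DecidableEq G]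
        (e : PermutationInversion.Idx n → G), Function.Injective e →
      ∀ (A : PermutationInversion.QuantumAlgorithm n G),
        ((Even n ∨ ε + 1 / (2 * (n : ℝ)) < 1 / 2) → A.uniformError e ≤ ε →
            c * Real.sqrt (n : ℝ) ≤ (A.queries : ℝ)) ∧
        ((∀ π : Equiv.Perm (PermutationInversion.Idx n), A.errorProb e π ≤ ε) →
            c * Real.sqrt (n : ℝ) ≤ (A.queries : ℝ)) := by
  obtain ⟨δ, rfl⟩ : ∃ δ, ε = 1 / 2 - δ := ⟨1 / 2 - ε, by ring⟩
  have hδ : 0 < δ := by linarith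
  -- The first term serves every case with a linear gap `δ / 2 * n`. The second serves odd `n` with
  -- `δ * n < 1`, where `√(δ * n) ≤ 1` and one query suffices for the bound.
  refine ⟨min (δ / 32) √δ, by positivity, fun n hn G _ _ _ e _ A => ?_⟩
  have hn0 : (0 : ℝ) < n := Nat.cast_pos.2 (by omega)
  have hs : 0 < √(n : ℝ) := Real.sqrt_pos.2 hn0
  have hss : √(n : ℝ) * √n = n := Real.mul_self_sqrt hn0.le
  have hsmall : δ / 32 * √n ≤ A.queries → min (δ / 32) √δ * √n ≤ A.queries := fun h =>
    (mul_le_mul_of_nonneg_right (min_le_left _ _) hs.le).trans h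
  constructor
  · intro hpar herr
    have h := A.card_evens_le e hn
    have hμ : n * A.uniformError e ≤ n * (1 / 2 - δ) := mul_le_mul_of_nonneg_left herr hn0.le
    rw [PermutationInversion.card_evens] at h
    have of_le (h : δ / 2 * n ≤ 16 * A.queries * √n) : min (δ / 32) √δ * √n ≤ A.queries := by
      refine hsmall (le_of_mul_le_mul_right ?_ hs)
      rw [mul_assoc, hss]
      linarith
    rcases Nat.even_or_odd' n with ⟨m, hm | hm⟩
    · have h2 : ((n / 2 : ℕ) : ℝ) = n / 2 := by
        have : n / 2 = m := by omega
        rw [this, hm]; push_cast; ring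
      apply of_le
      have : 0 < δ * n := by positivity
      linarith
    · have h2 : ((n / 2 : ℕ) : ℝ) = (n - 1) / 2 := by
        have : n / 2 = m := by omega
        rw [this, hm]; push_cast; ring
      -- The allowed error is below that of always answering "no".
      have hd : 1 < 2 * δ * n := by
        rcases hpar with hpar | hpar
        · exact absurd hpar (by rw [hm]; simp)
        · have h3 : 1 / (2 * (n : ℝ)) < δ := by linarith
          rw [div_lt_iff₀ (by positivity)] at h3
          linarith
      -- Here `h` gives `δ * n - 1 / 2 ≤ 16 * q * √n`. If `1 ≤ δ * n` the left side is at least `δ /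
      -- 2 * n`; otherwise `hd` still excludes `q = 0`.
      rcases le_or_gt 1 (δ * n) with h1 | h1
      · apply of_le
        linarith
      · have hq : (1 : ℝ) ≤ A.queries := by
          rcases Nat.eq_zero_or_pos A.queries with h0 | h0
          · rw [h0] at h
            norm_num at h
            linarith
          · exact_mod_cast h0
        refine le_trans ?_ hq
        calc min (δ / 32) √δ * √n ≤ √δ * √n :=
              mul_le_mul_of_nonneg_right (min_le_right _ _) hs.le
          _ = √(δ * n) := (Real.sqrt_mul hδ.le _).symm
          _ ≤ 1 := Real.sqrt_le_one.2 h1.le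
  · intro herr
    have h := A.card_evens_mul_le e hn herr
    rw [PermutationInversion.card_evens] at h
    -- Valid since `n ≥ 2`, with equality at `n = 3`.
    have h1 : (n : ℝ) / 3 ≤ (n / 2 : ℕ) := by
      rw [div_le_iff₀ (by norm_num)]
      exact_mod_cast (by omega : n ≤ n / 2 * 3)
    have h2 : (n : ℝ) / 2 ≤ n - (n / 2 : ℕ) := by
      have : ((n / 2 : ℕ) : ℝ) * 2 ≤ n := by exact_mod_cast Nat.div_mul_le_self n 2
      linarith
    have h3 : 2 * δ * ((n : ℝ) / 3 * (n / 2)) ≤ 8 * A.queries * √n * n := by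
      refine le_trans ?_ h
      rw [show 1 - 2 * (1 / 2 - δ) = 2 * δ by ring]
      gcongr
    have h4 : δ / 24 * n ≤ A.queries * √n := by
      refine le_of_mul_le_mul_right ?_ hn0
      linarith
    refine hsmall (le_of_mul_le_mul_right ?_ hs)
    rw [mul_assoc, hss]
    have : 0 < δ * n := by positivity
    linarith
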